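/- Let $b\ge 0$ and $c>0$ be real numbers, let $p\ge 1$ be an integer, let $s>3/2$ and $T\in(0,\infty]$, and let $\mathbb{S}=\mathbb{R}/\mathbb{Z}$ be the circle. Let $u\in C^0([0,T),H^s(\mathbb{S}))$ be a real-valued solution of $$u_t-u_{txx}+(b+c)u^pu_x=bu^{p-1}u_xu_{xx}+cu^pu_{xxx}\qquad\text{on }[0,T)\times\mathbb{S}.$$ Here "solution" means that for every $\varphi\in C^\infty(\mathbb{S})$ the function $t\mapsto\int_{\mathbb{S}}u(t,x)\,(\varphi-\varphi'')(x)\,dx$ is differentiable on $[0,T)$ (one-sidedly at $t=0$), with derivative $$-(b+c)\int_{\mathbb{S}}u^pu_x\varphi\,dx+b\,\langle u^{p-1}u_xu_{xx},\varphi\rangle+c\,\langle u^pu_{xxx},\varphi\rangle ,$$ where the products are the distributions $$u^{p-1}u_xu_{xx}=\tfrac12\big(u^{p-1}u_x^2\big)_x-\tfrac{p-1}{2}u^{p-2}u_x^3,$$ $$u^pu_{xxx}=(u^pu_x)_{xx}-3p\,u^{p-1}u_xu_{xx}-p(p-1)u^{p-2}u_x^3$$ (the terms with $u^{p-2}$ being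 absent when $p=1$). Each $u(t,\cdot)$ is identified with its continuous (indeed $C^1$) representative. If $u\not\equiv 0$ on $[0,T)\times\mathbb{S}$, then $u$ is not compactly supported; that is, the closure in $[0,T)\times\mathbb{S}$ of $\{(t,x)\in[0,T)\times\mathbb{S}:u(t,x)\neq 0\}$ is not compact. -/

import Mathlib

open Filter Topology MeasureTheory
open scoped ContDiff

noncomputable section

namespace PeriodicCH

/-- The circle of length one, that is, `[0, 1)` with its end points identified. -/
abbrev Circ : Type := UnitAddCircle

/-- The time interval `[0, T)`, with `T = ⊤` allowed. -/
def timeInterval (T : EReal) : Set ℝ := {t : ℝ | 0 ≤ t ∧ (t : EReal) < T}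

/-! ### Sobolev spaces on the circle -/

/-- The Fourier coefficients of a real function on the circle. -/
def fourierC (f : Circ → ℝ) (n : ℤ) : ℂ := fourierCoeff (fun x : Circ => (f x : ℂ)) n

/-- The `n`-th term of the square of the `H^s` norm. The weight is the `s`-th power of the
symbol `1 + (2 π n) ^ 2` of the operator `1 - ∂ₓ²`. -/
def sobolevTerm (s : ℝ) (f : Circ → ℝ) (n : ℤ) : ℝ :=
  (1 + (2 * Real.pi * (n : ℝ)) ^ 2) ^ s * ‖fourierC f n‖ ^ 2

/-- Membership in `H^s` of the circle, for `s ≥ 0`. -/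
def MemSobolev (s : ℝ) (f : Circ → ℝ) : Prop :=
  MemLp f 2 (volume : Measure Circ) ∧ Summable (sobolevTerm s f)

/-- The `H^s` norm, meaningful for functions with `MemSobolev s f`. -/
def sobolevNorm (s : ℝ) (f : Circ → ℝ) : ℝ := Real.sqrt (∑' n : ℤ, sobolevTerm s f n)

/-- `u ∈ C⁰([0, T), H^s)`. It is used for `s > 3/2 > 1/2` only, where every class in `H^s` has a
unique continuous representative, and `u t` is that representative. -/
def ContinuousInSobolev (s : ℝ) (T : EReal) (u : ℝ → C(Circ, ℝ)) : Prop :=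
  (∀ t ∈ timeInterval T, MemSobolev s (u t)) ∧
  ∀ t ∈ timeInterval T,
    Tendsto (fun τ : ℝ => sobolevNorm s (fun x : Circ => u τ x - u t x))
      (𝓝[timeInterval T] t) (𝓝 0)

/-! ### The equation -/

/-- The derivative of a function on the circle. (A function in `H^s`, `s > 3/2`, has a continuously
differentiable representative, so that this is the classical derivative of it.) -/
def dx (f : Circ → ℝ) (x : Circ) : ℝ := deriv (fun h : ℝ => f (x + (h : Circ))) 0

/-- Test functions: smooth functions on the circle. -/
def IsTest (φ : Circ → ℝ) : Prop := ContDiff ℝ ∞ (fun x : ℝ => φ (x : Circ))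

/-- The pairing of the distribution `v ^ (p - 1) * vₓ * vₓₓ` with `φ`, where the product is
`(1/2) * ((v ^ (p - 1) * vₓ ^ 2)ₓ - (p - 1) * v ^ (p - 2) * vₓ ^ 3)`. For `v` of class `C²` this is
`∫ v ^ (p - 1) * vₓ * vₓₓ * φ`, and it extends that functional continuously to `H^s`, `s > 3/2`.
(For `p = 1` the last term has the factor `p - 1 = 0`.) -/
def pairQuad (p : ℕ) (v φ : Circ → ℝ) : ℝ :=
  -(1 / 2) * (∫ x : Circ, v x ^ (p - 1) * dx v x ^ 2 * dx φ x)
    - ((p : ℝ) - 1) / 2 * (∫ x : Circ, v x ^ (p - 2) * dx v x ^ 3 * φ x)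

/-- The pairing of the distribution `v ^ p * vₓₓₓ` with `φ`, where the product is
`(v ^ p * vₓ)ₓₓ - 3 * p * (v ^ (p - 1) * vₓ * vₓₓ) - p * (p - 1) * v ^ (p - 2) * vₓ ^ 3`.
For `v` of class `C³` this is `∫ v ^ p * vₓₓₓ * φ`, and it extends that functional continuously
to `H^s`, `s > 3/2`. -/
def pairCubic (p : ℕ) (v φ : Circ → ℝ) : ℝ :=
  (∫ x : Circ, v x ^ p * dx v x * dx (dx φ) x)
    - 3 * (p : ℝ) * pairQuad p v φ
    - (p : ℝ) * ((p : ℝ) - 1) * (∫ x : Circ, v x ^ (p - 2) * dx v x ^ 3 * φ x)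

/-- `u` solves `u_t - u_txx + (b + c) u^p u_x = b u^(p-1) u_x u_xx + c u^p u_xxx` on `[0, T)` times
the circle: at every time `t` (at `t = 0` with the one-sided time derivative) the equation holds in
the sense of distributions on the circle. -/
def IsSolution (b c : ℝ) (p : ℕ) (T : EReal) (u : ℝ → C(Circ, ℝ)) : Prop :=
  ∀ φ : Circ → ℝ, IsTest φ → ∀ t ∈ timeInterval T,
    HasDerivWithinAt (fun τ : ℝ => ∫ x : Circ, u τ x * (φ x - dx (dx φ) x))
      (b * pairQuad p (u t) φ + c * pairCubic p (u t) φ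
        - (b + c) * (∫ x : Circ, u t x ^ p * dx (u t) x * φ x))
      (timeInterval T) t

/-- `u` is compactly supported in `[0, T)` times the circle: the closure, in this space, of the set
where `u` does not vanish is compact. -/
def CompactlySupported (T : EReal) (u : ℝ → C(Circ, ℝ)) : Prop :=
  HasCompactSupport (fun z : timeInterval T × Circ => u z.1 z.2)

end PeriodicCH

end

noncomputable section

namespace PeriodicCH

/-! Compact support in `[0,T) × 𝕊` forces `u` to vanish identically at some time `t₀ < T` beyond any
given time (`CompactlySupported.exists_time`). It remains to see that zero at `t₀` implies zero
earlier, `eq_zero_of_eq_zero_later`. This is uniqueness backward in time. Formally, `|d/dt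
‖u‖²_{H¹}| ≤ C ‖u‖²_{H¹}` with `C` depending only on a `C¹` bound for `u`, and the absolute value
makes Gronwall applicable in reversed time.

For `s` near `3/2` the formal computation is not available, so the energy is restricted to
frequencies `|n| ≤ N`. Its derivative is twice the weak equation tested with the truncation `P_N u`,
a legitimate test function (`hasDerivWithinAt_lowEnergy`, `sum_flux_mode`). The only dangerous term
is `c ∫ u^p u_x (P_N u)_xx`. Splitting `u_x = (P_N u)_x + (u_x - (P_N u)_x)`, the first part is
integrated by parts and the second is at most a constant times `‖u_x - (P_N u)_x‖₂ ‖(P_N u)_xx‖₂ =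
O(N^{3 - 2s})`. As `s > 3/2`, the error disappears as `N → ∞` (`abs_energy_integral_trunc_le`), and
Gronwall leaves every Fourier coefficient equal to zero. -/

/-! ### Absolutely convergent trigonometric series on the circle -/

lemma volume_eq_haarAddCircle : (volume : Measure Circ) = AddCircle.haarAddCircle := by
  have h := AddCircle.volume_eq_smul_haarAddCircle (T := (1 : ℝ))
  rw [ENNReal.ofReal_one, one_smul] at h
  exact h

/-- The trigonometric series with coefficients `a`, for summable `a`. -/
def trigSeries (a : ℤ → ℂ) : C(Circ, ℂ) := ∑' n, a n • fourier n

/-- The coefficients of the termwise derivative of a trigonometric series. -/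
def derivCoeff (a : ℤ → ℂ) (n : ℤ) : ℂ := 2 * Real.pi * Complex.I * n * a n

lemma norm_derivCoeff (a : ℤ → ℂ) (n : ℤ) :
    ‖derivCoeff a n‖ = |2 * Real.pi * (n : ℝ)| * ‖a n‖ := by
  simp [derivCoeff, abs_mul]

lemma norm_fourier_apply (n : ℤ) (x : Circ) : ‖fourier n x‖ = 1 := by
  rw [fourier_apply]
  exact Circle.norm_coe _

lemma summable_trigSeries {a : ℤ → ℂ} (ha : Summable fun n => ‖a n‖) :
    Summable fun n => a n • (fourier n : C(Circ, ℂ)) := by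
  refine Summable.of_norm ?_
  simpa [norm_smul, fourier_norm] using ha

lemma hasSum_trigSeries_apply {a : ℤ → ℂ} (ha : Summable fun n => ‖a n‖) (x : Circ) :
    HasSum (fun n => a n * fourier n x) (trigSeries a x) := by
  have h := (summable_trigSeries ha).hasSum
  have := h.mapL (ContinuousMap.evalCLM ℂ x)
  simpa [trigSeries] using this

lemma norm_trigSeries_apply_le {a : ℤ → ℂ} (ha : Summable fun n => ‖a n‖) (x : Circ) :
    ‖trigSeries a x‖ ≤ ∑' n, ‖a n‖ := by
  rw [← (hasSum_trigSeries_apply ha x).tsum_eq]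
  refine (norm_tsum_le_tsum_norm ?_).trans ?_ <;> simp [-fourier_apply, norm_fourier_apply, ha]

lemma fourierCoeff_fourier (m n : ℤ) :
    fourierCoeff (fourier m : Circ → ℂ) n = if m = n then 1 else 0 := by
  have h := orthonormal_iff_ite.mp (orthonormal_fourier (T := (1 : ℝ))) n m
  rw [ContinuousMap.inner_toLp] at h
  simp only [fourierCoeff, smul_eq_mul]
  simp only [eq_comm (a := m)]
  rw [← h]
  congr 1 with x
  simp [mul_comm]

lemma fourierCoeff_trigSeries {a : ℤ → ℂ} (ha : Summable fun n => ‖a n‖) (n : ℤ) :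
    fourierCoeff (trigSeries a) n = a n := by
  have h := hasSum_integral_of_summable_integral_norm (μ := AddCircle.haarAddCircle)
    (F := fun (m : ℤ) (x : Circ) => (fourier (-n) x : ℂ) • (a m * fourier m x)) ?_ ?_
  · have h1 : ∀ m : ℤ, ∫ x : Circ, (fourier (-n) x : ℂ) • (a m * fourier m x)
        ∂AddCircle.haarAddCircle = if m = n then a n else 0 := by
      intro m
      have := fourierCoeff_fourier m n
      simp only [fourierCoeff, smul_eq_mul] at this
      simp_rw [smul_eq_mul, mul_left_comm _ (a m)]
      rw [integral_const_mul, this]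
      split_ifs with hmn
      · simp [hmn]
      · simp
    simp_rw [h1] at h
    have h2 := h.unique (hasSum_ite_eq n (a n))
    rw [← h2, fourierCoeff]
    congr 1 with x
    rw [← (hasSum_trigSeries_apply ha x).tsum_eq, smul_eq_mul, ← tsum_mul_left]
    simp [smul_eq_mul]
  · intro m
    have hc : Continuous fun x : Circ => (fourier (-n) x : ℂ) • (a m * fourier m x) := by fun_prop
    exact hc.integrable_of_hasCompactSupport (HasCompactSupport.of_compactSpace _)
  · simpa [-fourier_apply, norm_fourier_apply] using ha

lemma integral_norm_sq_trigSeries {a : ℤ → ℂ} (ha : Summable fun n => ‖a n‖) :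
    ∫ x : Circ, ‖trigSeries a x‖ ^ 2 = ∑' n, ‖a n‖ ^ 2 := by
  rw [volume_eq_haarAddCircle]
  have h := tsum_sq_fourierCoeff
    (ContinuousMap.toLp 2 AddCircle.haarAddCircle ℂ (trigSeries a))
  simp_rw [fourierCoeff_toLp, fourierCoeff_trigSeries ha] at h
  rw [h]
  refine integral_congr_ae ?_
  filter_upwards [ContinuousMap.coeFn_toLp (p := 2) (𝕜 := ℂ) AddCircle.haarAddCircle
    (trigSeries a)] with x hx
  rw [hx]

lemma integrable_of_continuous {f : Circ → ℝ} (hf : Continuous f) : Integrable f :=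
  hf.integrable_of_hasCompactSupport (HasCompactSupport.of_compactSpace _)

lemma integral_re_trigSeries_sq_le {a : ℤ → ℂ} (ha : Summable fun n => ‖a n‖) :
    ∫ x : Circ, (trigSeries a x).re ^ 2 ≤ ∑' n, ‖a n‖ ^ 2 := by
  rw [← integral_norm_sq_trigSeries ha]
  refine integral_mono (integrable_of_continuous (by fun_prop))
    (integrable_of_continuous (by fun_prop)) fun x => ?_
  simpa using pow_le_pow_left₀ (abs_nonneg _) (Complex.abs_re_le_norm (trigSeries a x)) 2

lemma hasDerivAt_fourier_add (n : ℤ) (x : Circ) (y : ℝ) :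
    HasDerivAt (fun h : ℝ => (fourier n (x + (h : Circ)) : ℂ))
      (2 * Real.pi * Complex.I * n * fourier n (x + (y : Circ))) y := by
  have h := (hasDerivAt_fourier 1 n y).const_mul (fourier n x : ℂ)
  simp only [fourier_apply, smul_add, AddCircle.toCircle_add, Circle.coe_mul] at h ⊢
  refine h.congr_deriv ?_
  simp
  ring

lemma hasDerivAt_trigSeries {a : ℤ → ℂ} (ha : Summable fun n => ‖a n‖)
    (hd : Summable fun n => ‖derivCoeff a n‖) (x : Circ) (y : ℝ) :
    HasDerivAt (fun h : ℝ => trigSeries a (x + (h : Circ)))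
      (trigSeries (derivCoeff a) (x + (y : Circ))) y := by
  have h := hasDerivAt_tsum (𝕜 := ℝ) (g := fun (n : ℤ) (h : ℝ) => a n * fourier n (x + (h : Circ)))
    (g' := fun (n : ℤ) (h : ℝ) => derivCoeff a n * fourier n (x + (h : Circ))) (y₀ := y) hd
    (fun n y => ?_) (fun n y => by simp [-fourier_apply, norm_fourier_apply])
    (hasSum_trigSeries_apply ha _).summable y
  · rw [(hasSum_trigSeries_apply hd _).tsum_eq] at h
    simpa only [(hasSum_trigSeries_apply ha _).tsum_eq] using h
  · exact ((hasDerivAt_fourier_add n x y).const_mul (a n)).congr_deriv (by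
      simp only [derivCoeff]; ring)

lemma hasDerivAt_re {f : ℝ → ℂ} {f' : ℂ} {y : ℝ} (h : HasDerivAt f f' y) :
    HasDerivAt (fun z => (f z).re) f'.re y := by
  exact Complex.reCLM.hasFDerivAt.comp_hasDerivAt y h

/-- The integral of a derivative over the circle vanishes. -/
lemma integral_deriv_eq_zero {f f' : Circ → ℝ} (hf' : Continuous f')
    (h : ∀ y : ℝ, HasDerivAt (fun z : ℝ => f z) (f' y) y) : ∫ x, f' x = 0 := by
  rw [← UnitAddCircle.intervalIntegral_preimage 0 f',
    intervalIntegral.integral_eq_sub_of_hasDerivAt (f := fun z : ℝ => f z) (fun y _ => h y)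
      ((hf'.comp (AddCircle.continuous_mk' 1)).intervalIntegrable _ _)]
  have : ((0 + 1 : ℝ) : Circ) = ((0 : ℝ) : Circ) := by
    simp
  rw [this, sub_self]

/-! ### Sobolev bounds on Fourier coefficients -/

/-- The symbol of `1 - ∂ₓ²`. -/
def weight (n : ℤ) : ℝ := 1 + (2 * Real.pi * (n : ℝ)) ^ 2

lemma one_le_weight (n : ℤ) : 1 ≤ weight n := by
  unfold weight; nlinarith [sq_nonneg (2 * Real.pi * (n : ℝ))]

lemma weight_pos (n : ℤ) : 0 < weight n := one_pos.trans_le (one_le_weight n)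

lemma weight_mono {m n : ℤ} (h : |m| ≤ |n|) : weight m ≤ weight n := by
  have h2 : (m : ℝ) ^ 2 ≤ (n : ℝ) ^ 2 := by exact_mod_cast sq_le_sq.mpr h
  unfold weight
  rw [mul_pow, mul_pow _ (n : ℝ)]
  gcongr

lemma sobolevTerm_eq (s : ℝ) (f : Circ → ℝ) (n : ℤ) :
    sobolevTerm s f n = weight n ^ s * ‖fourierC f n‖ ^ 2 := rfl

lemma sobolevTerm_nonneg (s : ℝ) (f : Circ → ℝ) (n : ℤ) : 0 ≤ sobolevTerm s f n :=
  mul_nonneg (Real.rpow_nonneg (weight_pos n).le _) (sq_nonneg _)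

lemma sobolevTerm_mono {s r : ℝ} (h : r ≤ s) (f : Circ → ℝ) (n : ℤ) :
    sobolevTerm r f n ≤ sobolevTerm s f n :=
  mul_le_mul_of_nonneg_right (Real.rpow_le_rpow_of_exponent_le (one_le_weight n) h)
    (sq_nonneg _)

lemma norm_derivCoeff_sq (a : ℤ → ℂ) (n : ℤ) :
    ‖derivCoeff a n‖ ^ 2 = (weight n - 1) * ‖a n‖ ^ 2 := by
  rw [norm_derivCoeff, mul_pow, sq_abs, weight]; ring

lemma norm_derivCoeff_sq_le (a : ℤ → ℂ) (n : ℤ) :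
    ‖derivCoeff a n‖ ^ 2 ≤ weight n * ‖a n‖ ^ 2 := by
  rw [norm_derivCoeff_sq]; nlinarith [sq_nonneg ‖a n‖]

lemma summable_weight_rpow {r : ℝ} (hr : 1 / 2 < r) : Summable fun n => weight n ^ (-r) := by
  have h := Real.summable_abs_int_rpow (b := 2 * r) (by linarith)
  refine Summable.of_norm_bounded_eventually h ?_
  -- The comparison fails at `n = 0`, where `|0| ^ (-(2 * r))` is `0` while the weight is `1`.
  rw [Filter.eventually_cofinite]
  refine (Set.finite_singleton (0 : ℤ)).subset fun n hn => ?_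
  by_contra hn0
  refine hn ?_
  have hpos : 0 < |(n : ℝ)| := abs_pos.mpr (by exact_mod_cast hn0)
  rw [Real.norm_of_nonneg (Real.rpow_nonneg (weight_pos n).le _),
    show -(2 * r) = 2 * -r by ring, Real.rpow_mul hpos.le]
  refine Real.rpow_le_rpow_of_nonpos (by positivity) ?_ (by linarith)
  rw [Real.rpow_two, sq_abs, weight]
  have : (1 : ℝ) ≤ (2 * Real.pi) ^ 2 := by nlinarith [Real.pi_gt_three]
  nlinarith [sq_nonneg (n : ℝ)]

/-- The square of the left side is the product of the two terms on the right, and `x y ≤ (x + y)²`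
for `x, y ≥ 0`. Both terms are summable for `s > 3/2`, which gives the embedding of `H^s` into `C¹`.
-/
lemma sqrt_weight_mul_norm_le (s : ℝ) (f : Circ → ℝ) (n : ℤ) :
    √(weight n) * ‖fourierC f n‖ ≤ weight n ^ (-(s - 1)) + sobolevTerm s f n := by
  have hw := weight_pos n
  have h1 : (√(weight n) * ‖fourierC f n‖) ^ 2 = weight n ^ (-(s - 1)) * sobolevTerm s f n := by
    rw [mul_pow, Real.sq_sqrt hw.le, sobolevTerm_eq, ← mul_assoc, ← Real.rpow_add hw]
    simp
  have h2 : 0 ≤ weight n ^ (-(s - 1)) := Real.rpow_nonneg hw.le _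
  have h3 := sobolevTerm_nonneg s f n
  refine le_of_sq_le_sq ?_ (by positivity)
  rw [h1]
  nlinarith

lemma norm_fourierC_le (s : ℝ) (f : Circ → ℝ) (n : ℤ) :
    ‖fourierC f n‖ ≤ weight n ^ (-(s - 1)) + sobolevTerm s f n := by
  refine le_trans ?_ (sqrt_weight_mul_norm_le s f n)
  exact le_mul_of_one_le_left (norm_nonneg _) (Real.one_le_sqrt.mpr (one_le_weight n))

lemma norm_derivCoeff_fourierC_le (s : ℝ) (f : Circ → ℝ) (n : ℤ) :
    ‖derivCoeff (fourierC f) n‖ ≤ weight n ^ (-(s - 1)) + sobolevTerm s f n := by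
  refine le_trans ?_ (sqrt_weight_mul_norm_le s f n)
  rw [norm_derivCoeff]
  refine mul_le_mul_of_nonneg_right (Real.le_sqrt_of_sq_le ?_) (norm_nonneg _)
  rw [sq_abs, weight]
  linarith

/-! ### Embedding of `H^s` into `C¹` -/

section

variable {s : ℝ} {f : Circ → ℝ}

lemma summable_norm_fourierC (hs : 3 / 2 < s) (hf : Summable (sobolevTerm s f)) :
    Summable fun n => ‖fourierC f n‖ :=
  Summable.of_nonneg_of_le (fun _ => norm_nonneg _) (norm_fourierC_le s f)
    ((summable_weight_rpow (by linarith)).add hf)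

lemma summable_norm_derivCoeff (hs : 3 / 2 < s) (hf : Summable (sobolevTerm s f)) :
    Summable fun n => ‖derivCoeff (fourierC f) n‖ :=
  Summable.of_nonneg_of_le (fun _ => norm_nonneg _) (norm_derivCoeff_fourierC_le s f)
    ((summable_weight_rpow (by linarith)).add hf)

end

/-- The constant of the embedding of `H^s` into `C¹`. -/
def embeddingBound (s M : ℝ) : ℝ := 1 + ∑' n, weight n ^ (-(s - 1)) + M

section

variable {s : ℝ} {v : C(Circ, ℝ)}

lemma trigSeries_fourierC (hs : 3 / 2 < s) (hv : Summable (sobolevTerm s v)) (x : Circ) :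
    trigSeries (fourierC v) x = v x := by
  have h1 := (hasSum_trigSeries_apply (summable_norm_fourierC hs hv) x)
  have h2 := has_pointwise_sum_fourier_series_of_summable
    (f := ⟨fun x => (v x : ℂ), by fun_prop⟩) (summable_norm_fourierC hs hv).of_norm x
  exact h1.unique h2

lemma hasDerivAt_of_sobolev (hs : 3 / 2 < s) (hv : Summable (sobolevTerm s v))
    (x : Circ) (y : ℝ) :
    HasDerivAt (fun h : ℝ => v (x + (h : Circ)))
      (trigSeries (derivCoeff (fourierC v)) (x + (y : Circ))).re y := by
  have h := hasDerivAt_re (hasDerivAt_trigSeries (summable_norm_fourierC hs hv)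
    (summable_norm_derivCoeff hs hv) x y)
  simpa only [trigSeries_fourierC hs hv, Complex.ofReal_re] using h

lemma dx_eq_trigSeries (hs : 3 / 2 < s) (hv : Summable (sobolevTerm s v)) :
    dx v = fun x => (trigSeries (derivCoeff (fourierC v)) x).re := by
  funext x
  have := (hasDerivAt_of_sobolev hs hv x 0).deriv
  simpa [dx] using this

lemma continuous_dx (hs : 3 / 2 < s) (hv : Summable (sobolevTerm s v)) : Continuous (dx v) := by
  rw [dx_eq_trigSeries hs hv]; fun_prop

lemma hasDerivAt_dx (hs : 3 / 2 < s) (hv : Summable (sobolevTerm s v)) (y : ℝ) :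
    HasDerivAt (fun h : ℝ => v (h : Circ)) (dx v (y : Circ)) y := by
  simpa [dx_eq_trigSeries hs hv] using hasDerivAt_of_sobolev hs hv 0 y

lemma one_le_embeddingBound {M : ℝ}
    (hM : ∑' n, sobolevTerm s v n ≤ M) : 1 ≤ embeddingBound s M := by
  have h1 : 0 ≤ ∑' n, weight n ^ (-(s - 1)) :=
    tsum_nonneg fun n => Real.rpow_nonneg (weight_pos n).le _
  have h2 : 0 ≤ ∑' n, sobolevTerm s v n := tsum_nonneg (sobolevTerm_nonneg s v)
  unfold embeddingBound
  linarith

lemma tsum_le_embeddingBound {M : ℝ} (hs : 3 / 2 < s) (hv : Summable (sobolevTerm s v))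
    (hM : ∑' n, sobolevTerm s v n ≤ M) {a : ℤ → ℂ}
    (ha : ∀ n, ‖a n‖ ≤ weight n ^ (-(s - 1)) + sobolevTerm s v n) :
    ∑' n, ‖a n‖ ≤ embeddingBound s M := by
  have h1 := summable_weight_rpow (r := s - 1) (by linarith)
  have h2 := h1.add hv
  refine ((h2.of_nonneg_of_le (fun _ => norm_nonneg _) ha).tsum_le_tsum ha h2).trans ?_
  rw [h1.tsum_add hv]
  unfold embeddingBound
  linarith

lemma abs_le_embeddingBound {M : ℝ} (hs : 3 / 2 < s) (hv : Summable (sobolevTerm s v))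
    (hM : ∑' n, sobolevTerm s v n ≤ M) (x : Circ) : |v x| ≤ embeddingBound s M := by
  have h := norm_trigSeries_apply_le (summable_norm_fourierC hs hv) x
  rw [trigSeries_fourierC hs hv, Complex.norm_real] at h
  exact h.trans (tsum_le_embeddingBound hs hv hM (norm_fourierC_le s v))

lemma abs_dx_le_embeddingBound {M : ℝ} (hs : 3 / 2 < s) (hv : Summable (sobolevTerm s v))
    (hM : ∑' n, sobolevTerm s v n ≤ M) (x : Circ) : |dx v x| ≤ embeddingBound s M := by
  rw [dx_eq_trigSeries hs hv]
  exact ((Complex.abs_re_le_norm _).trans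
    (norm_trigSeries_apply_le (summable_norm_derivCoeff hs hv) x)).trans
    (tsum_le_embeddingBound hs hv hM (norm_derivCoeff_fourierC_le s v))

end

/-! ### Truncation of Fourier series -/

/-- The frequencies of absolute value at most `N`. -/
def lowFreq (N : ℕ) : Finset ℤ := Finset.Icc (-(N : ℤ)) N

lemma mem_lowFreq {N : ℕ} {n : ℤ} : n ∈ lowFreq N ↔ |n| ≤ N := by
  rw [lowFreq, Finset.mem_Icc, abs_le]

/-- Truncation of a sequence of coefficients to the low frequencies. -/
def trunc (N : ℕ) (a : ℤ → ℂ) (n : ℤ) : ℂ := if n ∈ lowFreq N then a n else 0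

lemma trunc_of_notMem {N : ℕ} {a : ℤ → ℂ} {n : ℤ} (h : n ∉ lowFreq N) : trunc N a n = 0 :=
  if_neg h

lemma trunc_of_mem {N : ℕ} {a : ℤ → ℂ} {n : ℤ} (h : n ∈ lowFreq N) : trunc N a n = a n :=
  if_pos h

lemma derivCoeff_trunc (N : ℕ) (a : ℤ → ℂ) : derivCoeff (trunc N a) = trunc N (derivCoeff a) := by
  funext n
  by_cases h : n ∈ lowFreq N <;> simp [derivCoeff, trunc, h]

lemma summable_norm_trunc (N : ℕ) (a : ℤ → ℂ) : Summable fun n => ‖trunc N a n‖ :=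
  summable_of_ne_finset_zero (s := lowFreq N) fun n hn => by simp [trunc_of_notMem hn]

lemma trigSeries_trunc_apply (N : ℕ) (a : ℤ → ℂ) (x : Circ) :
    trigSeries (trunc N a) x = ∑ n ∈ lowFreq N, a n * fourier n x := by
  rw [← (hasSum_trigSeries_apply (summable_norm_trunc N a) x).tsum_eq,
    tsum_eq_sum (s := lowFreq N) fun n hn => by simp [trunc_of_notMem hn]]
  exact Finset.sum_congr rfl fun n hn => by rw [trunc_of_mem hn]

/-- The square of the `H¹` norm of the low frequency part. -/
def lowEnergy (N : ℕ) (a : ℤ → ℂ) : ℝ := ∑ n ∈ lowFreq N, weight n * ‖a n‖ ^ 2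

lemma lowEnergy_nonneg (N : ℕ) (a : ℤ → ℂ) : 0 ≤ lowEnergy N a :=
  Finset.sum_nonneg fun n _ => mul_nonneg (weight_pos n).le (sq_nonneg _)

lemma integral_trunc_sq_le (N : ℕ) (a : ℤ → ℂ) :
    ∫ x : Circ, (trigSeries (trunc N a) x).re ^ 2 ≤ ∑ n ∈ lowFreq N, ‖a n‖ ^ 2 := by
  refine (integral_re_trigSeries_sq_le (summable_norm_trunc N a)).trans_eq ?_
  rw [tsum_eq_sum (s := lowFreq N) fun n hn => by simp [trunc_of_notMem hn]]
  exact Finset.sum_congr rfl fun n hn => by rw [trunc_of_mem hn]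

lemma integral_trunc_sq_le_lowEnergy (N : ℕ) (a : ℤ → ℂ) :
    ∫ x : Circ, (trigSeries (trunc N a) x).re ^ 2 ≤ lowEnergy N a :=
  (integral_trunc_sq_le N a).trans <| Finset.sum_le_sum fun n _ =>
    le_mul_of_one_le_left (sq_nonneg _) (one_le_weight n)

lemma integral_trunc_derivCoeff_sq_le_lowEnergy (N : ℕ) (a : ℤ → ℂ) :
    ∫ x : Circ, (trigSeries (trunc N (derivCoeff a)) x).re ^ 2 ≤ lowEnergy N a :=
  (integral_trunc_sq_le N _).trans <| Finset.sum_le_sum fun n _ => norm_derivCoeff_sq_le a n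

section

variable {s M : ℝ} {v : C(Circ, ℝ)}

/-- Two derivatives cost `weight n ^ 2`, of which `H^s` pays `weight n ^ s`. The excess power `2 -
s` is nonnegative, so it is largest at the cutoff. -/
lemma integral_trunc_derivCoeff_derivCoeff_sq_le (hs : s ≤ 2) (hv : Summable (sobolevTerm s v))
    (hM : ∑' n, sobolevTerm s v n ≤ M) (N : ℕ) :
    ∫ x : Circ, (trigSeries (trunc N (derivCoeff (derivCoeff (fourierC v)))) x).re ^ 2
      ≤ weight N ^ (2 - s) * M := by
  refine (integral_trunc_sq_le N _).trans ?_
  have h0 : 0 ≤ weight N ^ (2 - s) := Real.rpow_nonneg (weight_pos _).le _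
  calc ∑ n ∈ lowFreq N, ‖derivCoeff (derivCoeff (fourierC v)) n‖ ^ 2
      ≤ ∑ n ∈ lowFreq N, weight N ^ (2 - s) * sobolevTerm s v n := by
        refine Finset.sum_le_sum fun n hn => ?_
        have hw := weight_pos n
        have hle : weight n ≤ weight N := weight_mono (by simpa using mem_lowFreq.mp hn)
        calc ‖derivCoeff (derivCoeff (fourierC v)) n‖ ^ 2
            ≤ weight n * (weight n * ‖fourierC v n‖ ^ 2) :=
              (norm_derivCoeff_sq_le _ n).trans
                (mul_le_mul_of_nonneg_left (norm_derivCoeff_sq_le _ n) hw.le)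
          _ = weight n ^ (2 - s) * sobolevTerm s v n := by
              rw [sobolevTerm_eq, ← mul_assoc, ← mul_assoc, ← Real.rpow_add hw]
              congr 1
              rw [sub_add_cancel, Real.rpow_two, sq]
          _ ≤ _ := mul_le_mul_of_nonneg_right
              (Real.rpow_le_rpow hw.le hle (by linarith)) (sobolevTerm_nonneg s v n)
    _ = weight N ^ (2 - s) * ∑ n ∈ lowFreq N, sobolevTerm s v n := by rw [Finset.mul_sum]
    _ ≤ _ := mul_le_mul_of_nonneg_left
        ((hv.sum_le_tsum _ fun n _ => sobolevTerm_nonneg s v n).trans hM) h0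

/-- Only frequencies beyond `N` remain, and there the negative power `1 - s` of the weight is
bounded by its value at the cutoff. -/
lemma integral_dx_sub_trunc_sq_le (hs : 3 / 2 < s) (hv : Summable (sobolevTerm s v))
    (hM : ∑' n, sobolevTerm s v n ≤ M) (N : ℕ) :
    ∫ x : Circ, (dx v x - (trigSeries (trunc N (derivCoeff (fourierC v))) x).re) ^ 2
      ≤ weight N ^ (1 - s) * M := by
  have hd := summable_norm_derivCoeff hs hv
  set d := derivCoeff (fourierC v) with hd_def
  have ht := summable_norm_trunc N d
  have hr : Summable fun n => ‖d n - trunc N d n‖ :=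
    (hd.add ht).of_nonneg_of_le (fun _ => norm_nonneg _) fun n => norm_sub_le _ _
  have hsub : ∀ x, dx v x - (trigSeries (trunc N d) x).re
      = (trigSeries (fun n => d n - trunc N d n) x).re := by
    intro x
    have h := (hasSum_trigSeries_apply hd x).sub (hasSum_trigSeries_apply ht x)
    simp_rw [← sub_mul] at h
    rw [(hasSum_trigSeries_apply hr x).unique h, Complex.sub_re, dx_eq_trigSeries hs hv]
  simp_rw [hsub]
  refine (integral_re_trigSeries_sq_le hr).trans ?_
  have hle : ∀ n, ‖d n - trunc N d n‖ ^ 2 ≤ weight N ^ (1 - s) * sobolevTerm s v n := by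
    intro n
    have h0 : 0 ≤ weight N ^ (1 - s) * sobolevTerm s v n :=
      mul_nonneg (Real.rpow_nonneg (weight_pos _).le _) (sobolevTerm_nonneg s v n)
    by_cases hn : n ∈ lowFreq N
    · simpa [trunc_of_mem hn] using h0
    · have hw := weight_pos n
      have hlt : weight N ≤ weight n := by
        refine weight_mono ?_
        rw [mem_lowFreq, not_le] at hn
        simpa using hn.le
      rw [trunc_of_notMem hn, sub_zero]
      calc ‖d n‖ ^ 2 ≤ weight n * ‖fourierC v n‖ ^ 2 := norm_derivCoeff_sq_le _ n
        _ = weight n ^ (1 - s) * sobolevTerm s v n := by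
            rw [sobolevTerm_eq, ← mul_assoc, ← Real.rpow_add hw, sub_add_cancel, Real.rpow_one]
        _ ≤ _ := mul_le_mul_of_nonneg_right
            (Real.rpow_le_rpow_of_nonpos (weight_pos _) hlt (by linarith))
            (sobolevTerm_nonneg s v n)
  have hsum := hv.mul_left (weight N ^ (1 - s))
  refine ((hsum.of_nonneg_of_le (fun _ => sq_nonneg _) hle).tsum_le_tsum hle hsum).trans ?_
  rw [tsum_mul_left]
  exact mul_le_mul_of_nonneg_left hM (Real.rpow_nonneg (weight_pos _).le _)

end

/-! ### The energy estimate -/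

/-- The factor of the test function itself in the weak form of the right-hand side. -/
def density₀ (b c : ℝ) (p : ℕ) (u w : ℝ) : ℝ :=
  -((b - 3 * p * c) * ((p : ℝ) - 1) / 2 + c * p * ((p : ℝ) - 1)) * (u ^ (p - 2) * w ^ 3)
    - (b + c) * (u ^ p * w)

/-- The factor of the first derivative of the test function. -/
def density₁ (b c : ℝ) (p : ℕ) (u w : ℝ) : ℝ :=
  -((b - 3 * p * c) / 2) * (u ^ (p - 1) * w ^ 2)

/-- The factor of the second derivative of the test function. -/
def density₂ (c : ℝ) (p : ℕ) (u w : ℝ) : ℝ := c * (u ^ p * w)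

/-- The constant in the energy estimate for functions bounded in `C¹` by `K`. -/
def energyConst (b c : ℝ) (p : ℕ) (K : ℝ) : ℝ :=
  (|(b - 3 * p * c) * ((p : ℝ) - 1) / 2 + c * p * ((p : ℝ) - 1)| + |b + c|
    + |(b - 3 * p * c) / 2| + |c| * (p + 1)) * K ^ (p + 2)

lemma energyConst_nonneg (b c : ℝ) (p : ℕ) {K : ℝ} (hK : 1 ≤ K) : 0 ≤ energyConst b c p K := by
  unfold energyConst; positivity

/-- With `K ≥ 1`, a single power of `K` serves for monomials of all the degrees that occur. -/
lemma abs_monomial_le {u w K : ℝ} {i j m : ℕ} (hK : 1 ≤ K) (hu : |u| ≤ K) (hw : |w| ≤ K)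
    (h : i + j ≤ m) : |u ^ i * w ^ j| ≤ K ^ m := by
  have h0 : 0 ≤ K := by linarith
  calc |u ^ i * w ^ j| = |u| ^ i * |w| ^ j := by rw [abs_mul, abs_pow, abs_pow]
    _ ≤ K ^ i * K ^ j := by gcongr
    _ = K ^ (i + j) := (pow_add _ _ _).symm
    _ ≤ K ^ m := pow_le_pow_right₀ hK h

lemma abs_mul_mul_mul_le {α m x y B Q : ℝ} (hm : |m| ≤ B) (hxy : |x * y| ≤ Q) :
    |α * m * (x * y)| ≤ |α| * B * Q := by
  rw [abs_mul, abs_mul]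
  exact mul_le_mul (mul_le_mul_of_nonneg_left hm (abs_nonneg α)) hxy (abs_nonneg _)
    (mul_nonneg (abs_nonneg α) ((abs_nonneg m).trans hm))

lemma abs_mul_le_weighted {x y l : ℝ} (hl : 0 < l) : |x * y| ≤ l * x ^ 2 + l⁻¹ * y ^ 2 := by
  have h1 : (l * x ^ 2) * (l⁻¹ * y ^ 2) = (x * y) ^ 2 := by field_simp
  have h2 : 0 ≤ l * x ^ 2 := by positivity
  have h3 : 0 ≤ l⁻¹ * y ^ 2 := by positivity
  refine abs_le_of_sq_le_sq ?_ (by positivity)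
  rw [← h1]
  nlinarith

/-- The integrand of the energy identity after an integration by parts in the leading term. -/
lemma abs_energy_integrand_le (b c : ℝ) {p : ℕ} (hp : 1 ≤ p) {u w v₀ v₁ v₂ K l : ℝ} (hK : 1 ≤ K)
    (hu : |u| ≤ K) (hw : |w| ≤ K) (hl : 0 < l) :
    |density₀ b c p u w * v₀ + density₁ b c p u w * v₁ + c * u ^ p * ((w - v₁) * v₂)
        - c * (p / 2) * (u ^ (p - 1) * w) * v₁ ^ 2|
      ≤ energyConst b c p K
        * (w ^ 2 + v₀ ^ 2 + v₁ ^ 2 + (l * (w - v₁) ^ 2 + l⁻¹ * v₂ ^ 2)) := by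
  set Q := w ^ 2 + v₀ ^ 2 + v₁ ^ 2 + (l * (w - v₁) ^ 2 + l⁻¹ * v₂ ^ 2)
  have hq : 0 ≤ l * (w - v₁) ^ 2 + l⁻¹ * v₂ ^ 2 := by positivity
  have hQ0 : 0 ≤ Q := by positivity
  set α := (b - 3 * p * c) * ((p : ℝ) - 1) / 2 + c * p * ((p : ℝ) - 1)
  set β := (b - 3 * p * c) / 2
  -- Each summand is a constant times a bounded monomial in `u, w` times a product of two factors
  -- that `Q` controls.
  have e : density₀ b c p u w * v₀ + density₁ b c p u w * v₁ + c * u ^ p * ((w - v₁) * v₂)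
        - c * (p / 2) * (u ^ (p - 1) * w) * v₁ ^ 2
      = -α * (u ^ (p - 2) * w ^ 2) * (w * v₀) + -(b + c) * (u ^ p * w ^ 0) * (w * v₀)
        + -β * (u ^ (p - 1) * w ^ 1) * (w * v₁) + c * (u ^ p * w ^ 0) * ((w - v₁) * v₂)
        + -(c * (p / 2)) * (u ^ (p - 1) * w ^ 1) * (v₁ * v₁) := by
    simp only [density₀, density₁, α, β]; ring
  have h0 : |w * v₀| ≤ Q := by
    have := abs_mul_le_weighted (x := w) (y := v₀) one_pos
    rw [inv_one, one_mul, one_mul] at this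
    linarith [sq_nonneg v₁]
  have h1 : |w * v₁| ≤ Q := by
    have := abs_mul_le_weighted (x := w) (y := v₁) one_pos
    rw [inv_one, one_mul, one_mul] at this
    linarith [sq_nonneg v₀]
  have h2 : |(w - v₁) * v₂| ≤ Q := by
    have := abs_mul_le_weighted (x := w - v₁) (y := v₂) hl
    linarith [sq_nonneg v₀, sq_nonneg w, sq_nonneg v₁]
  have h3 : |v₁ * v₁| ≤ Q := by
    rw [abs_mul_self]; linarith [sq_nonneg v₀, sq_nonneg w]
  have hpa : |(p : ℝ)| = p := abs_of_nonneg (Nat.cast_nonneg p)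
  have hB : 0 ≤ K ^ (p + 2) := by positivity
  rw [e]
  have t1 := abs_mul_mul_mul_le (α := -α) (abs_monomial_le (i := p - 2) (j := 2) (m := p + 2)
    hK hu hw (by omega)) h0
  have t2 := abs_mul_mul_mul_le (α := -(b + c)) (abs_monomial_le (i := p) (j := 0) (m := p + 2)
    hK hu hw (by omega)) h0
  have t3 := abs_mul_mul_mul_le (α := -β) (abs_monomial_le (i := p - 1) (j := 1) (m := p + 2)
    hK hu hw (by omega)) h1
  have t4 := abs_mul_mul_mul_le (α := c) (abs_monomial_le (i := p) (j := 0) (m := p + 2)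
    hK hu hw (by omega)) h2
  have t5 := abs_mul_mul_mul_le (α := -(c * (p / 2))) (abs_monomial_le (i := p - 1) (j := 1)
    (m := p + 2) hK hu hw (by omega)) h3
  rw [abs_neg] at t1 t2 t3 t5
  rw [abs_mul c, abs_div, hpa, abs_two] at t5
  refine (abs_add_le _ _).trans ((add_le_add ((abs_add_le _ _).trans (add_le_add
    ((abs_add_le _ _).trans (add_le_add ((abs_add_le _ _).trans (add_le_add t1 t2)) t3)) t4))
    t5).trans ?_)
  have h5 : 0 ≤ |c| * (p / 2) * K ^ (p + 2) * Q := by positivity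
  have h6 : energyConst b c p K * Q = |α| * K ^ (p + 2) * Q + |b + c| * K ^ (p + 2) * Q
      + |β| * K ^ (p + 2) * Q + |c| * K ^ (p + 2) * Q + |c| * (p / 2) * K ^ (p + 2) * Q
      + |c| * (p / 2) * K ^ (p + 2) * Q := by
    unfold energyConst; ring
  linarith

/-- Here `w = u_x`, and `v₀, v₁, v₂` stand for the truncation of `u` and its first two derivatives.
The leading term uses `w v₂ = (w - v₁) v₂ + v₁ v₂` and `u^p v₁ v₂ = ½ (u^p v₁²)_x - (p/2) u^(p-1) w
v₁²`. -/
lemma abs_energy_integral_le (b c : ℝ) {p : ℕ} (hp : 1 ≤ p) {u w v₀ v₁ v₂ : Circ → ℝ} {K l : ℝ}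
    (hK : 1 ≤ K) (hl : 0 < l)
    (hu : Continuous u) (hw : Continuous w) (hv₀ : Continuous v₀) (hv₁ : Continuous v₁)
    (hv₂ : Continuous v₂) (huK : ∀ x, |u x| ≤ K) (hwK : ∀ x, |w x| ≤ K)
    (hdu : ∀ y : ℝ, HasDerivAt (fun z : ℝ => u z) (w y) y)
    (hdv : ∀ y : ℝ, HasDerivAt (fun z : ℝ => v₁ z) (v₂ y) y) :
    |∫ x, (density₀ b c p (u x) (w x) * v₀ x + density₁ b c p (u x) (w x) * v₁ x
        + density₂ c p (u x) (w x) * v₂ x)|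
      ≤ energyConst b c p K * ((∫ x, w x ^ 2) + (∫ x, v₀ x ^ 2) + (∫ x, v₁ x ^ 2)
        + (l * (∫ x, (w x - v₁ x) ^ 2) + l⁻¹ * ∫ x, v₂ x ^ 2)) := by
  let G : Circ → ℝ := fun x => density₀ b c p (u x) (w x) * v₀ x
    + density₁ b c p (u x) (w x) * v₁ x + c * u x ^ p * ((w x - v₁ x) * v₂ x)
        - c * (p / 2) * (u x ^ (p - 1) * w x) * v₁ x ^ 2
  -- The exact derivative of `(c/2) u^p v₁²`, whose integral over the circle vanishes.
  let R : Circ → ℝ := fun x => c / 2 * ((p * u x ^ (p - 1) * w x) * v₁ x ^ 2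
    + u x ^ p * (2 * v₁ x * v₂ x))
  have hGc : Continuous G := by unfold G density₀ density₁; fun_prop
  have hRc : Continuous R := by unfold R; fun_prop
  have hR0 : ∫ x, R x = 0 := by
    refine integral_deriv_eq_zero (f := fun x => c / 2 * (u x ^ p * v₁ x ^ 2)) hRc fun y => ?_
    refine ((((hdu y).pow p).mul ((hdv y).pow 2)).const_mul (c / 2)).congr_deriv ?_
    simp [R]
  have hsplit : ∀ x, density₀ b c p (u x) (w x) * v₀ x + density₁ b c p (u x) (w x) * v₁ x
      + density₂ c p (u x) (w x) * v₂ x = G x + R x := by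
    intro x
    simp only [G, R, density₂]
    ring
  have iw := integrable_of_continuous (f := fun x => w x ^ 2) (by fun_prop)
  have i0 := integrable_of_continuous (f := fun x => v₀ x ^ 2) (by fun_prop)
  have i1 := integrable_of_continuous (f := fun x => v₁ x ^ 2) (by fun_prop)
  have i2 := (integrable_of_continuous (f := fun x => v₂ x ^ 2) (by fun_prop)).const_mul l⁻¹
  have i3 := (integrable_of_continuous (f := fun x => (w x - v₁ x) ^ 2) (by fun_prop)).const_mul l
  simp_rw [hsplit]
  rw [integral_add (integrable_of_continuous hGc) (integrable_of_continuous hRc), hR0, add_zero]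
  refine abs_integral_le_integral_abs.trans ((integral_mono
    (integrable_of_continuous hGc.abs) (integrable_of_continuous (by fun_prop))
    fun x => abs_energy_integrand_le b c hp hK (huK x) (hwK x) hl
      (v₀ := v₀ x) (v₁ := v₁ x) (v₂ := v₂ x)).trans_eq ?_)
  have j0 : Integrable fun x => w x ^ 2 + v₀ x ^ 2 := iw.add i0
  have j1 : Integrable fun x => w x ^ 2 + v₀ x ^ 2 + v₁ x ^ 2 := j0.add i1
  have j2 : Integrable fun x => l * (w x - v₁ x) ^ 2 + l⁻¹ * v₂ x ^ 2 := i3.add i2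
  rw [integral_const_mul, integral_add j1 j2, integral_add j0 i1,
    integral_add iw i0, integral_add i3 i2, integral_const_mul,
    integral_const_mul]

/-- The energy estimate for the low frequency part of a function in `H^s`. -/
lemma abs_energy_integral_trunc_le (b c : ℝ) {p : ℕ} (hp : 1 ≤ p) {s M : ℝ} (hs : 3 / 2 < s)
    (hs2 : s ≤ 2) {v : C(Circ, ℝ)} (hv : Summable (sobolevTerm s v))
    (hM : ∑' n, sobolevTerm s v n ≤ M) (N : ℕ) :
    |∫ x, (density₀ b c p (v x) (dx v x) * (trigSeries (trunc N (fourierC v)) x).re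
        + density₁ b c p (v x) (dx v x) * (trigSeries (trunc N (derivCoeff (fourierC v))) x).re
        + density₂ c p (v x) (dx v x)
          * (trigSeries (trunc N (derivCoeff (derivCoeff (fourierC v)))) x).re)|
      ≤ energyConst b c p (embeddingBound s M)
        * (4 * lowEnergy N (fourierC v) + 4 * M * weight N ^ (3 / 2 - s)) := by
  set a := fourierC v
  set κ := weight N
  have hκ : 0 < κ := weight_pos N
  have hκ1 : 1 ≤ κ := one_le_weight N
  have hM0 : 0 ≤ M := (tsum_nonneg (sobolevTerm_nonneg s v)).trans hM
  have hK := one_le_embeddingBound (v := v) hM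
  -- The choice `l = κ ^ (1/2)` balances the tail `κ ^ (1 - s)` against the second derivative `κ ^
  -- (2 - s)`: both become `κ ^ (3/2 - s)`.
  refine (abs_energy_integral_le b c hp (l := κ ^ (1 / 2 : ℝ)) hK (by positivity) v.continuous
    (continuous_dx hs hv) (by fun_prop) (by fun_prop) (by fun_prop)
    (abs_le_embeddingBound hs hv hM) (abs_dx_le_embeddingBound hs hv hM)
    (hasDerivAt_dx hs hv) fun y => ?_).trans ?_
  · have h := hasDerivAt_re (hasDerivAt_trigSeries (summable_norm_trunc N (derivCoeff a))
      (by rw [derivCoeff_trunc]; exact summable_norm_trunc N _) 0 y)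
    simpa [derivCoeff_trunc] using h
  refine mul_le_mul_of_nonneg_left ?_ (energyConst_nonneg b c p hK)
  have e0 := integral_trunc_sq_le_lowEnergy N a
  have e1 := integral_trunc_derivCoeff_sq_le_lowEnergy N a
  have e2 := integral_trunc_derivCoeff_derivCoeff_sq_le hs2 hv hM N
  have e3 := integral_dx_sub_trunc_sq_le hs hv hM N
  have hdc := continuous_dx hs hv
  -- The full derivative is not controlled by the low energy; its tail goes into the error.
  have ew : ∫ x, dx v x ^ 2 ≤ 2 * (∫ x, (trigSeries (trunc N (derivCoeff a)) x).re ^ 2)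
      + 2 * ∫ x, (dx v x - (trigSeries (trunc N (derivCoeff a)) x).re) ^ 2 := by
    rw [← integral_const_mul, ← integral_const_mul, ← integral_add
      (integrable_of_continuous (by fun_prop)) (integrable_of_continuous (by fun_prop))]
    refine integral_mono (integrable_of_continuous (by fun_prop))
      (integrable_of_continuous (by fun_prop)) fun x => ?_
    nlinarith [sq_nonneg (dx v x - 2 * (trigSeries (trunc N (derivCoeff a)) x).re)]
  have hl : κ ^ (1 / 2 : ℝ) * (κ ^ (1 - s) * M) = M * κ ^ (3 / 2 - s) := by
    rw [← mul_assoc, ← Real.rpow_add hκ, mul_comm]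
    ring_nf
  have hl' : (κ ^ (1 / 2 : ℝ))⁻¹ * (κ ^ (2 - s) * M) = M * κ ^ (3 / 2 - s) := by
    rw [← Real.rpow_neg hκ.le, ← mul_assoc, ← Real.rpow_add hκ, mul_comm]
    ring_nf
  have f3 := mul_le_mul_of_nonneg_left e3 (by positivity : 0 ≤ κ ^ (1 / 2 : ℝ))
  have f2 := mul_le_mul_of_nonneg_left e2 (by positivity : 0 ≤ (κ ^ (1 / 2 : ℝ))⁻¹)
  have g : κ ^ (1 - s) * M ≤ M * κ ^ (3 / 2 - s) := by
    rw [mul_comm]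
    exact mul_le_mul_of_nonneg_left
      (Real.rpow_le_rpow_of_exponent_le hκ1 (by linarith)) hM0
  change κ ^ (1 / 2 : ℝ) * _ ≤ κ ^ (1 / 2 : ℝ) * (κ ^ (1 - s) * M) at f3
  change (κ ^ (1 / 2 : ℝ))⁻¹ * _ ≤ (κ ^ (1 / 2 : ℝ))⁻¹ * (κ ^ (2 - s) * M) at f2
  linarith

/-! ### The equation tested with Fourier modes -/

/-- The real Fourier modes. -/
def mode (n : ℤ) (z : ℂ) (x : Circ) : ℝ := (z * fourier n x).re

lemma continuous_mode (n : ℤ) (z : ℂ) : Continuous (mode n z) := by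
  unfold mode; fun_prop

lemma isTest_mode (n : ℤ) (z : ℂ) : IsTest (mode n z) := by
  unfold IsTest mode
  simp_rw [fourier_coe_apply]
  have h : ContDiff ℝ ∞ fun x : ℝ =>
      z * Complex.exp (2 * Real.pi * Complex.I * n * x / (1 : ℝ)) :=
    contDiff_const.mul
      (((contDiff_const.mul Complex.ofRealCLM.contDiff).div_const _).cexp)
  exact Complex.reCLM.contDiff.comp h

lemma dx_mode (n : ℤ) (z : ℂ) : dx (mode n z) = mode n (2 * Real.pi * Complex.I * n * z) := by
  funext x
  have h := (hasDerivAt_re ((hasDerivAt_fourier_add n x 0).const_mul z)).deriv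
  unfold dx mode
  rw [h]
  simp only [AddCircle.coe_zero, add_zero]
  congr 1
  ring

/-- Modes are eigenfunctions of `1 - ∂ₓ²`, so testing with one isolates a single Fourier
coefficient. -/
lemma mode_sub_dx_dx (n : ℤ) (z : ℂ) (x : Circ) :
    mode n z x - dx (dx (mode n z)) x = weight n * mode n z x := by
  have e : 2 * (Real.pi : ℂ) * Complex.I * n * (2 * Real.pi * Complex.I * n * z) * fourier n x
      = (-(2 * Real.pi * n) ^ 2 : ℝ) * (z * fourier n x) := by
    push_cast
    linear_combination (2 * Real.pi * n) ^ 2 * z * fourier n x * Complex.I_sq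
  rw [dx_mode, dx_mode]
  unfold mode weight
  rw [e, Complex.re_ofReal_mul]
  ring

/-- The right-hand side of the equation tested with `φ`. -/
def flux (b c : ℝ) (p : ℕ) (v φ : Circ → ℝ) : ℝ :=
  b * pairQuad p v φ + c * pairCubic p v φ - (b + c) * (∫ x : Circ, v x ^ p * dx v x * φ x)

/-- Terms are collected by the number of derivatives falling on the test function. -/
lemma flux_eq_integral (b c : ℝ) (p : ℕ) {v φ : Circ → ℝ} (hv : Continuous v)
    (hdv : Continuous (dx v)) (hφ : Continuous φ) (hφ₁ : Continuous (dx φ))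
    (hφ₂ : Continuous (dx (dx φ))) :
    flux b c p v φ = ∫ x, (density₀ b c p (v x) (dx v x) * φ x
      + density₁ b c p (v x) (dx v x) * dx φ x + density₂ c p (v x) (dx v x) * dx (dx φ) x) := by
  have i1 := integrable_of_continuous (f := fun x => v x ^ (p - 2) * dx v x ^ 3 * φ x) (by fun_prop)
  have i2 := integrable_of_continuous (f := fun x => v x ^ p * dx v x * φ x) (by fun_prop)
  have i3 := integrable_of_continuous (f := fun x => v x ^ (p - 1) * dx v x ^ 2 * dx φ x)
    (by fun_prop)
  have i4 := integrable_of_continuous (f := fun x => v x ^ p * dx v x * dx (dx φ) x) (by fun_prop)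
  have e : ∀ x, density₀ b c p (v x) (dx v x) * φ x
      + density₁ b c p (v x) (dx v x) * dx φ x + density₂ c p (v x) (dx v x) * dx (dx φ) x
      = -((b - 3 * p * c) * ((p : ℝ) - 1) / 2 + c * p * ((p : ℝ) - 1))
          * (v x ^ (p - 2) * dx v x ^ 3 * φ x)
        + -(b + c) * (v x ^ p * dx v x * φ x)
        + -((b - 3 * p * c) / 2) * (v x ^ (p - 1) * dx v x ^ 2 * dx φ x)
        + c * (v x ^ p * dx v x * dx (dx φ) x) := by
    intro x
    simp only [density₀, density₁, density₂]
    ring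
  set k₁ := -((b - 3 * p * c) * ((p : ℝ) - 1) / 2 + c * p * ((p : ℝ) - 1)) with hk₁
  have j1 := i1.const_mul k₁
  have j2 := i2.const_mul (-(b + c))
  have j3 := i3.const_mul (-((b - 3 * p * c) / 2))
  have j12 : Integrable fun x => k₁ * (v x ^ (p - 2) * dx v x ^ 3 * φ x)
    + -(b + c) * (v x ^ p * dx v x * φ x) := j1.add j2
  have j123 : Integrable fun x => k₁ * (v x ^ (p - 2) * dx v x ^ 3 * φ x)
    + -(b + c) * (v x ^ p * dx v x * φ x)
    + -((b - 3 * p * c) / 2) * (v x ^ (p - 1) * dx v x ^ 2 * dx φ x) := j12.add j3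
  simp_rw [e]
  rw [integral_add j123 (i4.const_mul c), integral_add j12 j3, integral_add j1 j2]
  simp_rw [integral_const_mul]
  simp only [flux, pairCubic, pairQuad, hk₁]
  ring

/-- Real linearity in `z`: the tests with `1` and `Complex.I`, weighted by the parts of `a`,
recombine into one mode. -/
lemma mode_combination (n : ℤ) (q a : ℂ) (x : Circ) :
    a.re * mode n (q * 1) x + a.im * mode n (q * Complex.I) x = mode n (q * a) x := by
  simp only [mode, Complex.mul_re, Complex.mul_im, Complex.I_re, Complex.I_im, Complex.one_re,
    Complex.one_im]
  ring

/-- The sum of the right-hand sides tested with the low Fourier modes of a function. -/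
lemma sum_flux_mode (b c : ℝ) (p : ℕ) {v : Circ → ℝ} (hv : Continuous v)
    (hdv : Continuous (dx v)) (N : ℕ) (a : ℤ → ℂ) :
    ∑ n ∈ lowFreq N, ((a n).re * flux b c p v (mode n 1)
        + (a n).im * flux b c p v (mode n Complex.I))
      = ∫ x, (density₀ b c p (v x) (dx v x) * (trigSeries (trunc N a) x).re
        + density₁ b c p (v x) (dx v x) * (trigSeries (trunc N (derivCoeff a)) x).re
        + density₂ c p (v x) (dx v x)
          * (trigSeries (trunc N (derivCoeff (derivCoeff a))) x).re) := by
  have hd0 : Continuous fun x => density₀ b c p (v x) (dx v x) := by unfold density₀; fun_prop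
  have hd1 : Continuous fun x => density₁ b c p (v x) (dx v x) := by unfold density₁; fun_prop
  have hd2 : Continuous fun x => density₂ c p (v x) (dx v x) := by unfold density₂; fun_prop
  have hm := continuous_mode
  set D : ℤ → ℂ := fun n => 2 * Real.pi * Complex.I * n with hD
  have hflux : ∀ n z, flux b c p v (mode n z) = ∫ x, (density₀ b c p (v x) (dx v x) * mode n z x
      + density₁ b c p (v x) (dx v x) * mode n (D n * z) x
      + density₂ c p (v x) (dx v x) * mode n (D n * (D n * z)) x) := by
    intro n z
    rw [flux_eq_integral b c p hv hdv (hm _ _) (by rw [dx_mode]; exact hm _ _)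
      (by rw [dx_mode, dx_mode]; exact hm _ _), dx_mode, dx_mode]
  have hint : ∀ n z, Integrable fun x => density₀ b c p (v x) (dx v x) * mode n z x
      + density₁ b c p (v x) (dx v x) * mode n (D n * z) x
      + density₂ c p (v x) (dx v x) * mode n (D n * (D n * z)) x := fun n z =>
    integrable_of_continuous (((hd0.mul (hm _ _)).add (hd1.mul (hm _ _))).add (hd2.mul (hm _ _)))
  have hterm : ∀ n, (a n).re * flux b c p v (mode n 1) + (a n).im * flux b c p v (mode n Complex.I)
      = ∫ x, (density₀ b c p (v x) (dx v x) * mode n (a n) x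
        + density₁ b c p (v x) (dx v x) * mode n (D n * a n) x
        + density₂ c p (v x) (dx v x) * mode n (D n * (D n * a n)) x) := by
    intro n
    rw [hflux, hflux, ← integral_const_mul, ← integral_const_mul,
      ← integral_add ((hint _ _).const_mul _) ((hint _ _).const_mul _)]
    congr 1 with x
    have c0 := mode_combination n 1 (a n) x
    have c1 := mode_combination n (D n) (a n) x
    have c2 := mode_combination n (D n * D n) (a n) x
    simp only [one_mul, mul_assoc] at c0 c1 c2
    linear_combination density₀ b c p (v x) (dx v x) * c0 + density₁ b c p (v x) (dx v x) * c1
      + density₂ c p (v x) (dx v x) * c2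
  simp_rw [hterm]
  rw [← integral_finsetSum _ fun n _ => hint n (a n)]
  congr 1 with x
  simp only [trigSeries_trunc_apply, Complex.re_sum, Finset.mul_sum, Finset.sum_add_distrib]
  rfl

/-! ### Evolution of the Fourier coefficients and of the low-frequency energy -/

lemma continuous_fourierC_integrand (f : C(Circ, ℝ)) (n : ℤ) :
    Continuous fun x : Circ => (fourier (-n) x : ℂ) • (f x : ℂ) := by
  fun_prop

lemma fourierC_eq (f : C(Circ, ℝ)) (n : ℤ) :
    fourierC f n = ((∫ x, f x * mode n 1 x : ℝ) : ℂ)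
      + ((∫ x, f x * mode n Complex.I x : ℝ) : ℂ) * Complex.I := by
  have hi : ∀ z, Integrable fun x => f x * mode n z x := fun z =>
    integrable_of_continuous (f.continuous.mul (continuous_mode n z))
  rw [← integral_complex_ofReal, ← integral_complex_ofReal, ← integral_mul_const,
    ← integral_add (hi _).ofReal ((hi _).ofReal.mul_const _), fourierC, fourierCoeff,
    volume_eq_haarAddCircle]
  congr 1 with x
  rw [fourier_neg]
  apply Complex.ext <;> simp [-fourier_apply, mode] <;> ring

lemma fourierC_add (f g : C(Circ, ℝ)) (n : ℤ) :
    fourierC f n = fourierC (fun x => f x - g x) n + fourierC g n := by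
  have hc := continuous_fourierC_integrand
  have hi : ∀ h : C(Circ, ℝ), Integrable (fun x : Circ => (fourier (-n) x : ℂ) • (h x : ℂ))
      AddCircle.haarAddCircle := fun h =>
    (hc h n).integrable_of_hasCompactSupport (HasCompactSupport.of_compactSpace _)
  unfold fourierC fourierCoeff
  refine Eq.trans ?_ (integral_add (hi (f - g)) (hi g))
  congr 1 with x
  simp [-fourier_apply]
  ring

section

variable {b c : ℝ} {p : ℕ} {T : EReal} {u : ℝ → C(Circ, ℝ)}

lemma hasDerivWithinAt_integral_mode (hsol : IsSolution b c p T u) {t : ℝ}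
    (ht : t ∈ timeInterval T) (n : ℤ) (z : ℂ) :
    HasDerivWithinAt (fun τ => ∫ x, u τ x * mode n z x)
      ((weight n)⁻¹ * flux b c p (u t) (mode n z)) (timeInterval T) t := by
  have h := (hsol _ (isTest_mode n z) t ht).const_mul (weight n)⁻¹
  refine h.congr_of_eventuallyEq (.of_forall fun τ => ?_) ?_ <;>
  · simp only [mode_sub_dx_dx, mul_left_comm _ (weight n)]
    rw [integral_const_mul, inv_mul_cancel_left₀ (weight_pos n).ne']

lemma lowEnergy_fourierC (N : ℕ) (f : C(Circ, ℝ)) :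
    lowEnergy N (fourierC f) = ∑ n ∈ lowFreq N,
      weight n * ((∫ x, f x * mode n 1 x) ^ 2 + (∫ x, f x * mode n Complex.I x) ^ 2) := by
  refine Finset.sum_congr rfl fun n _ => ?_
  rw [fourierC_eq, Complex.sq_norm, Complex.normSq_add_mul_I]

/-- The `H¹` weight cancels the inverse symbol in the evolution of each coefficient, leaving the
weak equation tested with the truncated solution. -/
lemma hasDerivWithinAt_lowEnergy (hsol : IsSolution b c p T u) {t : ℝ}
    (ht : t ∈ timeInterval T) (N : ℕ) :
    HasDerivWithinAt (fun τ => lowEnergy N (fourierC (u τ)))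
      (2 * ∑ n ∈ lowFreq N, ((fourierC (u t) n).re * flux b c p (u t) (mode n 1)
        + (fourierC (u t) n).im * flux b c p (u t) (mode n Complex.I))) (timeInterval T) t := by
  simp_rw [lowEnergy_fourierC]
  rw [Finset.mul_sum]
  refine HasDerivWithinAt.fun_sum fun n _ => ?_
  have h1 := hasDerivWithinAt_integral_mode hsol ht n 1
  have h2 := hasDerivWithinAt_integral_mode hsol ht n Complex.I
  refine (((h1.fun_pow 2).fun_add (h2.fun_pow 2)).const_mul (weight n)).congr_deriv ?_
  have hw := (weight_pos n).ne'
  rw [fourierC_eq]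
  simp
  field_simp

/-! ### Uniform bounds in time -/

lemma sobolevTerm_le_two_mul (s : ℝ) (f g : C(Circ, ℝ)) (n : ℤ) :
    sobolevTerm s f n ≤ 2 * sobolevTerm s (fun x => f x - g x) n + 2 * sobolevTerm s g n := by
  have h0 : 0 ≤ weight n ^ s := Real.rpow_nonneg (weight_pos n).le _
  have h1 : ‖fourierC f n‖ ≤ ‖fourierC (fun x => f x - g x) n‖ + ‖fourierC g n‖ := by
    rw [fourierC_add f g n]; exact norm_add_le _ _
  have h2 := pow_le_pow_left₀ (norm_nonneg _) h1 2
  have h3 := h2.trans (add_sq_le (a := ‖fourierC (fun x => f x - g x) n‖) (b := ‖fourierC g n‖))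
  simp only [sobolevTerm_eq]
  linarith [mul_le_mul_of_nonneg_left h3 h0]

lemma summable_sobolevTerm_sub {s : ℝ} {f g : C(Circ, ℝ)} (hf : Summable (sobolevTerm s f))
    (hg : Summable (sobolevTerm s g)) : Summable (sobolevTerm s fun x => f x - g x) := by
  refine ((hf.mul_left 2).add (hg.mul_left 2)).of_nonneg_of_le (sobolevTerm_nonneg s _) fun n => ?_
  have h0 : 0 ≤ weight n ^ s := Real.rpow_nonneg (weight_pos n).le _
  have h1 : ‖fourierC (fun x => f x - g x) n‖ ≤ ‖fourierC f n‖ + ‖fourierC g n‖ := by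
    rw [← sub_eq_of_eq_add (fourierC_add f g n)]; exact norm_sub_le _ _
  have h2 := pow_le_pow_left₀ (norm_nonneg _) h1 2
  have h3 := h2.trans (add_sq_le (a := ‖fourierC f n‖) (b := ‖fourierC g n‖))
  simp only [sobolevTerm_eq]
  linarith [mul_le_mul_of_nonneg_left h3 h0]

/-- Continuity in `H^s` gives a bound near each time, and compactness makes it uniform. -/
lemma exists_tsum_sobolevTerm_le {s : ℝ} (hu : ContinuousInSobolev s T u) {J : Set ℝ}
    (hJ : IsCompact J) (hJT : J ⊆ timeInterval T) :
    ∃ M, ∀ t ∈ J, ∑' n, sobolevTerm s (u t) n ≤ M := by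
  refine hJ.induction_on (p := fun J => ∃ M, ∀ t ∈ J, ∑' n, sobolevTerm s (u t) n ≤ M)
    ⟨0, by simp⟩ (fun A B hAB ⟨M, hM⟩ => ⟨M, fun t ht => hM t (hAB ht)⟩)
    (fun A B ⟨M, hM⟩ ⟨M', hM'⟩ => ⟨max M M', fun t ht => ?_⟩) fun t ht => ?_
  · rcases ht with ht | ht
    · exact (hM t ht).trans (le_max_left _ _)
    · exact (hM' t ht).trans (le_max_right _ _)
  · have hev := (hu.2 t (hJT ht)).eventually (gt_mem_nhds one_pos)
    refine ⟨{τ | τ ∈ J ∧ sobolevNorm s (fun x => u τ x - u t x) < 1},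
      inter_mem self_mem_nhdsWithin (nhdsWithin_mono t hJT hev),
      2 + 2 * ∑' n, sobolevTerm s (u t) n, fun τ hτ => ?_⟩
    have h1 := (hu.1 t (hJT ht)).2
    have h2 := (hu.1 τ (hJT hτ.1)).2
    -- Summability is needed for the norm of the difference to carry information: a divergent `tsum`
    -- would be `0`.
    have h3 := summable_sobolevTerm_sub h2 h1
    have h4 : ∑' n, sobolevTerm s (fun x => u τ x - u t x) n ≤ 1 := by
      have := hτ.2
      rw [sobolevNorm, Real.sqrt_lt' one_pos, one_pow] at this
      exact this.le
    have h5 := h2.tsum_le_tsum (sobolevTerm_le_two_mul s (u τ) (u t))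
      ((h3.mul_left 2).add (h1.mul_left 2))
    rw [(h3.mul_left 2).tsum_add (h1.mul_left 2), tsum_mul_left, tsum_mul_left] at h5
    linarith

/-! ### Backward uniqueness of the zero solution -/

lemma tendsto_weight_rpow {r : ℝ} (hr : r < 0) :
    Tendsto (fun N : ℕ => weight N ^ r) atTop (𝓝 0) := by
  have h1 : Tendsto (fun N : ℕ => weight N) atTop atTop := by
    refine tendsto_atTop_mono (fun N => ?_) (tendsto_natCast_atTop_atTop (R := ℝ))
    have : (1 : ℝ) ≤ (2 * Real.pi) ^ 2 := by nlinarith [Real.pi_gt_three]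
    rw [weight, mul_pow]
    push_cast
    nlinarith [sq_nonneg ((N : ℝ) - 1), sq_nonneg (N : ℝ)]
  have h2 := (tendsto_rpow_neg_atTop (y := -r) (by linarith)).comp h1
  simpa [Function.comp_def] using h2

/-- A solution that vanishes at the time `t₀` has vanished at all earlier times. -/
theorem eq_zero_of_eq_zero_later (hp : 1 ≤ p) {s : ℝ} (hs : 3 / 2 < s)
    (hu : ContinuousInSobolev s T u) (hsol : IsSolution b c p T u) {t t₀ : ℝ} (ht : 0 ≤ t)
    (htt : t ≤ t₀) (ht₀ : (t₀ : EReal) < T) (hzero : u t₀ = 0) : u t = 0 := by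
  have hJT : Set.Icc t t₀ ⊆ timeInterval T := fun τ hτ =>
    ⟨ht.trans hτ.1, (EReal.coe_le_coe_iff.mpr hτ.2).trans_lt ht₀⟩
  obtain ⟨M, hM⟩ := exists_tsum_sobolevTerm_le hu isCompact_Icc hJT
  -- The bound on the truncated second derivative needs an exponent at most `2`; lowering `s` keeps
  -- it above `3/2`.
  set r := min s 2
  have hr : 3 / 2 < r := lt_min hs (by norm_num)
  have hr2 : r ≤ 2 := min_le_right _ _
  have hsum : ∀ τ ∈ Set.Icc t t₀, Summable (sobolevTerm r (u τ)) := fun τ hτ =>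
    (hu.1 τ (hJT hτ)).2.of_nonneg_of_le (sobolevTerm_nonneg r _)
      (sobolevTerm_mono (min_le_left _ _) _)
  have hMr : ∀ τ ∈ Set.Icc t t₀, ∑' n, sobolevTerm r (u τ) n ≤ M := fun τ hτ =>
    ((hsum τ hτ).tsum_le_tsum (sobolevTerm_mono (min_le_left _ _) _)
      (hu.1 τ (hJT hτ)).2).trans (hM τ hτ)
  set C := energyConst b c p (embeddingBound r M)
  have hC : 0 ≤ C := energyConst_nonneg b c p
    (one_le_embeddingBound (hMr t ⟨le_rfl, htt⟩))
  -- The factor `8` is `2` from differentiating squares times `4` from the energy estimate; adding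
  -- `1` keeps the Gronwall constant nonzero.
  set L := 8 * C + 1
  have hL : 0 < L := by positivity
  have hbound : ∀ N, lowEnergy N (fourierC (u t))
      ≤ 8 * C * M * weight N ^ (3 / 2 - r) / L * (Real.exp (L * (t₀ - t)) - 1) := by
    intro N
    set E : ℝ → ℝ := fun τ => lowEnergy N (fourierC (u τ)) with hE
    set E' : ℝ → ℝ := fun τ => 2 * ∑ n ∈ lowFreq N,
      ((fourierC (u τ) n).re * flux b c p (u τ) (mode n 1)
        + (fourierC (u τ) n).im * flux b c p (u τ) (mode n Complex.I)) with hE'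
    have hder : ∀ τ ∈ Set.Icc t t₀, HasDerivWithinAt E (E' τ) (timeInterval T) τ := fun τ hτ =>
      hasDerivWithinAt_lowEnergy hsol (hJT hτ) N
    have hE0 : E t₀ = 0 := by simp [hE, lowEnergy, fourierC, fourierCoeff, hzero]
    have hmaps : Set.MapsTo (fun q => t₀ - q) (Set.Icc 0 (t₀ - t)) (Set.Icc t t₀) :=
      fun q hq => ⟨by linarith [hq.2], by linarith [hq.1]⟩
    -- Gronwall runs in reversed time `q = t₀ - τ`, starting from zero energy at `t₀`.
    have hg := norm_le_gronwallBound_of_norm_deriv_right_le (f := fun q => E (t₀ - q))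
      (f' := fun q => -E' (t₀ - q)) (δ := 0) (K := L) (ε := 8 * C * M * weight N ^ (3 / 2 - r))
      (a := 0) (b := t₀ - t) ?_ ?_ (by simp [hE0]) ?_ (t₀ - t) ⟨by linarith, le_rfl⟩
    · rw [gronwallBound_of_K_ne_0 hL.ne'] at hg
      simp only [sub_sub_cancel, sub_zero, zero_mul, zero_add] at hg
      exact (le_abs_self _).trans hg
    · have hEc : ContinuousOn E (Set.Icc t t₀) := fun τ hτ =>
        (hder τ hτ).continuousWithinAt.mono hJT
      exact hEc.comp (continuousOn_const.sub continuousOn_id) hmaps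
    · intro q hq
      have hτ := hmaps ⟨hq.1, hq.2.le⟩
      have hpos : 0 < t₀ - q := by linarith [hq.2]
      -- Since `q < t₀ - t`, the time `t₀ - q` is interior, so the one-sided derivative is two-sided
      -- there.
      have hnhds : timeInterval T ∈ 𝓝 (t₀ - q) := by
        obtain ⟨t₁, h1, h2⟩ := EReal.lt_iff_exists_real_btwn.mp ht₀
        have h3 : t₀ < t₁ := EReal.coe_lt_coe_iff.mp h1
        filter_upwards [Ioo_mem_nhds hpos (show t₀ - q < t₁ by linarith [hq.1])] with τ h
        exact ⟨h.1.le, (EReal.coe_lt_coe_iff.mpr h.2).trans h2⟩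
      have h := ((hder _ hτ).hasDerivAt hnhds).scomp q ((hasDerivAt_id q).const_sub t₀)
      simpa [Function.comp_def] using h.hasDerivWithinAt
    · intro q hq
      have hτ := hmaps ⟨hq.1, hq.2.le⟩
      have h := abs_energy_integral_trunc_le b c hp hr hr2 (hsum _ hτ) (hMr _ hτ) N
      have hEn : 0 ≤ E (t₀ - q) := lowEnergy_nonneg N _
      rw [← sum_flux_mode b c p (u _).continuous (continuous_dx hr (hsum _ hτ)) N] at h
      rw [norm_neg, Real.norm_eq_abs, Real.norm_of_nonneg hEn, hE', abs_mul, abs_two]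
      change |_| ≤ C * (4 * E (t₀ - q) + _) at h
      simp only [L]
      linarith
  have hlim : Tendsto (fun N : ℕ => 8 * C * M * weight N ^ (3 / 2 - r) / L
      * (Real.exp (L * (t₀ - t)) - 1)) atTop (𝓝 0) := by
    have := (((tendsto_weight_rpow (r := 3 / 2 - r) (by linarith)).const_mul
      (8 * C * M)).div_const L).mul_const (Real.exp (L * (t₀ - t)) - 1)
    simpa using this
  have hcoeff : ∀ n, fourierC (u t) n = 0 := by
    intro n
    have hle : weight n * ‖fourierC (u t) n‖ ^ 2 ≤ 0 := by
      refine ge_of_tendsto hlim ?_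
      -- For fixed `n`, the coefficient belongs to the low energy as soon as `N ≥ |n|`.
      filter_upwards [eventually_ge_atTop n.natAbs] with N hN
      refine le_trans ?_ (hbound N)
      refine Finset.single_le_sum (f := fun n => weight n * ‖fourierC (u t) n‖ ^ 2)
        (fun m _ => mul_nonneg (weight_pos m).le (sq_nonneg _)) ?_
      rw [mem_lowFreq, Int.abs_eq_natAbs]
      exact_mod_cast hN
    have h1 : ‖fourierC (u t) n‖ ^ 2 ≤ 0 := by
      nlinarith [weight_pos n, one_le_weight n, sq_nonneg ‖fourierC (u t) n‖]
    simpa using h1.antisymm (sq_nonneg _)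
  ext x
  have h := hasSum_trigSeries_apply
    (summable_norm_fourierC hr (hsum t ⟨le_rfl, htt⟩)) x
  rw [trigSeries_fourierC hr (hsum t ⟨le_rfl, htt⟩)] at h
  simp only [hcoeff, zero_mul] at h
  simpa using h.unique hasSum_zero

/-- The support of a compactly supported function stays away from the end of the time interval. -/
lemma CompactlySupported.exists_time (hcs : CompactlySupported T u) {t : ℝ}
    (ht : t ∈ timeInterval T) : ∃ t₀, t ≤ t₀ ∧ (t₀ : EReal) < T ∧ u t₀ = 0 := by
  set S := tsupport (fun z : timeInterval T × Circ => u z.1 z.2)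
  -- Inserting `t` makes the compact set nonempty and its maximum at least `t`; any time strictly
  -- between that maximum and `T` misses the support.
  have hK : IsCompact (insert t ((fun z : timeInterval T × Circ => (z.1 : ℝ)) '' S)) :=
    (IsCompact.image hcs (by fun_prop)).insert t
  obtain ⟨m, hm, hmax⟩ := hK.exists_isGreatest (Set.insert_nonempty _ _)
  have hmT : (m : EReal) < T := by
    rcases hm with rfl | ⟨z, -, rfl⟩
    · exact ht.2
    · exact z.1.2.2
  obtain ⟨t₀, h1, h2⟩ := EReal.lt_iff_exists_real_btwn.mp hmT
  have h3 : m < t₀ := EReal.coe_lt_coe_iff.mp h1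
  have htm : t ≤ m := hmax (Set.mem_insert _ _)
  refine ⟨t₀, htm.trans h3.le, h2, ?_⟩
  ext x
  by_contra hne
  have hmem : ((⟨t₀, ht.1.trans (htm.trans h3.le), h2⟩ : timeInterval T), x) ∈ S :=
    subset_tsupport _ hne
  exact absurd (hmax (Set.mem_insert_of_mem _ ⟨_, hmem, rfl⟩)) (not_le.mpr h3)

end

end PeriodicCH

end

theorem theorem6p1 (b c : ℝ) (hb : 0 ≤ b) (hc : 0 < c) (p : ℕ) (hp : 1 ≤ p)
    (s : ℝ) (hs : 3 / 2 < s) (T : EReal) (hT : 0 < T)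
    (u : ℝ → C(PeriodicCH.Circ, ℝ))
    (hu : PeriodicCH.ContinuousInSobolev s T u)
    (hsol : PeriodicCH.IsSolution b c p T u)
    (hne : ∃ t ∈ PeriodicCH.timeInterval T, ∃ x : PeriodicCH.Circ, u t x ≠ 0) :
    ¬ PeriodicCH.CompactlySupported T u := by
  intro hcs
  obtain ⟨t, ht, x, hx⟩ := hne
  obtain ⟨t₀, htt, ht₀, hzero⟩ := hcs.exists_time ht
  refine hx ?_
  rw [PeriodicCH.eq_zero_of_eq_zero_later hp hs hu hsol ht.1 htt ht₀ hzero]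
  rfl
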